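/- For a real matrix $A=\begin{bmatrix}a&b\\c&d\end{bmatrix}$ let \[\mathrm{CD}(A)=\bar D\Big(\tfrac{a+d}2+\tfrac{c-b}2\,\mathrm i,\ \sqrt{(\tfrac{a-d}2)^2+(\tfrac{b+c}2)^2}\Big)\subset\mathbb C\] be its chiral disk, where $D(z,r)$ and $\bar D(z,r)$ denote the open and the closed disk of center $z$ and radius $r$. For an atomless $\mathrm M_2(\mathbb R)$-valued measure $\phi$ on a compact interval $[\alpha,\beta]$ let \[\mathrm{Lexp}(\phi)=\sum_{n\ge0}\ \int_{\alpha\le s_1\le\dots\le s_n\le\beta}\phi(s_n)\cdots\phi(s_1)\] be its left time-ordered exponential, and let $\int\|\phi\|_2$ be its cumulative norm, i.e. its total variation with respect to the operator norm induced by the Euclidean norm of $\mathbb R^2$. The Magnus exponent of $A$ is \[\mathrm{MP}(A)=\inf\Big\{\int\|\phi\|_2\ :\ \mathrm{Lexp}(\phi)=A\Big\}\in[0,\infty],\] the infimum being over all such intervals and measures. Theorem. Suppose that $A\in \mathrm M_2(\mathbb R)$ satisfies $\mathrm{CD}(A)\subset\exp D(0,\pi)$. Then $\mathrm{MP}(A)$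 is finite, and \[\mathrm{MP}(A)=\inf\{\lambda\in[0,\pi)\ :\ \mathrm{CD}(A)\subset\exp\bar D(0,\lambda)\},\] where the infimum is attained (it is a minimum). In other words, \[\mathrm{MP}(A)=\sup\{|\log z|\ :\ z\in\mathrm{CD}(A)\},\] where $\log$ is the principal branch of the logarithm. -/

import Mathlib

open MeasureTheory Set
open scoped ENNReal

namespace Magnus

noncomputable section

/-- The `n`-th iterated ordered integral of an algebra-valued measure `φ`,
`∫_{a ≤ s₁ ≤ ⋯ ≤ sₙ ≤ t} φ(sₙ) ⋯ φ(s₁)`, as a function of the upper end `t`. The integrand is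
paired with the measure by multiplication, with the measure as the left factor. -/
def lexpTerm {𝔄 : Type*} [NormedRing 𝔄] [NormedAlgebra ℝ 𝔄]
    (φ : VectorMeasure ℝ 𝔄) (a : ℝ) : ℕ → ℝ → 𝔄
  | 0 => fun _ => 1
  | n + 1 => fun t =>
      VectorMeasure.integral (φ.restrict (Icc a t)) (fun s => lexpTerm φ a n s)
        (ContinuousLinearMap.mul ℝ 𝔄).flip

/-- The left time-ordered exponential of `φ` on `[a, b]`:
`∑ₙ ∫_{a ≤ s₁ ≤ ⋯ ≤ sₙ ≤ b} φ(sₙ) ⋯ φ(s₁)`. -/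
def lexp {𝔄 : Type*} [NormedRing 𝔄] [NormedAlgebra ℝ 𝔄]
    (φ : VectorMeasure ℝ 𝔄) (a b : ℝ) : 𝔄 :=
  ∑' n : ℕ, lexpTerm φ a n b

open scoped Matrix.Norms.L2Operator in
/-- `φ`, considered on the interval `[a, b]`, is a Magnus presentation of the real `2 × 2` matrix
`A`: it is a continuous (atomless) matrix-valued measure on `[a, b]` whose left time-ordered
exponential is `A`. -/
def IsPresentation (A : Matrix (Fin 2) (Fin 2) ℝ) (a b : ℝ)
    (φ : VectorMeasure ℝ (Matrix (Fin 2) (Fin 2) ℝ)) : Prop :=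
  a ≤ b ∧ (∀ x ∈ Icc a b, φ {x} = 0) ∧ lexp φ a b = A

open scoped Matrix.Norms.L2Operator in
/-- The cumulative norm `∫ ‖φ‖₂` over `[a, b]`: the total variation of `φ` on `[a, b]` with respect
to the operator norm that comes from the Euclidean norm of `ℝ²`. -/
def cumulativeNorm (a b : ℝ) (φ : VectorMeasure ℝ (Matrix (Fin 2) (Fin 2) ℝ)) : ℝ≥0∞ :=
  φ.variation (Icc a b)

/-- The Magnus exponent: the infimum of the cumulative norms of the Magnus presentations of `A`
(infinite if there is none). -/
def magnusExponent (A : Matrix (Fin 2) (Fin 2) ℝ) : ℝ≥0∞ :=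
  sInf {v : ℝ≥0∞ | ∃ (a b : ℝ) (φ : VectorMeasure ℝ (Matrix (Fin 2) (Fin 2) ℝ)),
    IsPresentation A a b φ ∧ v = cumulativeNorm a b φ}

/-- The chiral disk of a real `2 × 2` matrix. -/
def chiralDisk (A : Matrix (Fin 2) (Fin 2) ℝ) : Set ℂ :=
  Metric.closedBall
    (⟨(A 0 0 + A 1 1) / 2, (A 1 0 - A 0 1) / 2⟩ : ℂ)
    (Real.sqrt (((A 0 0 - A 1 1) / 2) ^ 2 + ((A 0 1 + A 1 0) / 2) ^ 2))

end

end Magnus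

/-!
Identify `ℝ²` with `ℂ` and write the matrix as `v ↦ p v + q v̄`; its chiral disk is the closed disk
of center `p` and radius `|q|`, and the boundary circle consists of the quotients `A v / v`.

Lower bound: along a time-ordered exponential `X_t` the point `X_t v / v` moves in `ℂ` with
logarithmic speed at most the norm of the measure, so `|log (A v / v)|` is at most the cumulative
norm. Apply this to the point of the chiral disk where `|log|` is maximal; it lies on the boundary
circle.

Upper bound: at the maximum point `z₀ = exp (l (c + i ω))` the chiral disk is tangent to the curve
`|log z| = l`, so its center is determined by its radius `r`. As `|log| ≤ l` on the disk, its
interior cannot contain the mirror point `exp (l (-c + i ω))` of this curve, which gives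
`r ≤ sinh (c l) / c` (by a second order argument if `c = 0`, with bound `l`). Every tangent disk
with such a radius is the chiral disk of a matrix that is reached in time `l` by a linear ordinary
differential equation with coefficient of norm at most `1`, whose antilinear part rotates uniformly.
-/

namespace Magnus

open Filter Topology

section Distribution

theorem monotone_measureReal_Iic (ν : Measure ℝ) [IsFiniteMeasure ν] :
    Monotone fun t => ν.real (Iic t) :=
  fun _ _ h => measureReal_mono (Iic_subset_Iic.2 h)

theorem tendsto_measureReal_Iic_atTop (ν : Measure ℝ) [IsFiniteMeasure ν] :
    Tendsto (fun t => ν.real (Iic t)) atTop (𝓝 (ν.real univ)) :=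
  (ENNReal.tendsto_toReal (measure_ne_top ν _)).comp (tendsto_measure_Iic_atTop ν)

theorem tendsto_measureReal_Iic_atBot (ν : Measure ℝ) [IsFiniteMeasure ν] :
    Tendsto (fun t => ν.real (Iic t)) atBot (𝓝 0) := by
  have h := tendsto_measure_iInter_atBot (μ := ν) (s := Iic)
    (fun _ => measurableSet_Iic.nullMeasurableSet) (fun _ _ => Iic_subset_Iic.2)
    ⟨0, measure_ne_top ν _⟩
  have h_empty : ⋂ t : ℝ, Iic t = ∅ := iInter_Iic_eq_empty_iff (f := id).2 (by simp)
  rw [h_empty, measure_empty] at h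
  exact (ENNReal.tendsto_toReal ENNReal.zero_ne_top).comp h

variable (ν : Measure ℝ) [IsFiniteMeasure ν] [NullSingletonClass ν]

theorem continuous_setIntegral_Icc {E : Type*} [NormedAddCommGroup E] [NormedSpace ℝ E]
    {f : ℝ → E} (hf : Continuous f) (a : ℝ) : Continuous fun t => ∫ x in Icc a t, f x ∂ν := by
  have h_eq : (fun t => ∫ x in Icc a t, f x ∂ν) = fun t => ∫ x in a..max a t, f x ∂ν := by
    funext t
    rw [intervalIntegral.integral_of_le (le_max_left a t), ← integral_Icc_eq_integral_Ioc]
    rcases le_total a t with h | h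
    · rw [max_eq_right h]
    · rw [max_eq_left h, Icc_self, setIntegral_measure_zero f (measure_singleton a),
        setIntegral_measure_zero f (measure_mono_null (Icc_subset_Icc_right h) (by simp))]
  rw [h_eq]
  exact (intervalIntegral.continuous_primitive (fun _ _ => hf.intervalIntegrable _ _) a).comp
    (continuous_const.max continuous_id)

theorem continuous_measureReal_Icc (a : ℝ) : Continuous fun t => ν.real (Icc a t) := by
  simpa using continuous_setIntegral_Icc ν (continuous_const (y := (1 : ℝ))) a

theorem continuous_measureReal_Iic : Continuous fun t => ν.real (Iic t) := by
  have h_eq : (fun t => ν.real (Iic t)) = fun t => ν.real (Iic 0) + ∫ _ in 0..t, (1 : ℝ) ∂ν := by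
    funext t
    rw [← intervalIntegral.integral_Iic_sub_Iic (by simp) (by simp)]
    simp [Measure.real]
  rw [h_eq]
  exact continuous_const.add
    (intervalIntegral.continuous_primitive (fun _ _ => intervalIntegrable_const) 0)

theorem measure_preimage_measureReal_Iic {x : ℝ} (hx : x < ν.real univ) :
    ν ((fun t => ν.real (Iic t)) ⁻¹' Iic x) = ENNReal.ofReal x := by
  have h_cont := continuous_measureReal_Iic ν
  have h_mono := monotone_measureReal_Iic ν
  set S := (fun t => ν.real (Iic t)) ⁻¹' Iic x
  obtain ⟨b, hb⟩ := ((tendsto_measureReal_Iic_atTop ν).eventually_const_lt hx).exists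
  rcases S.eq_empty_or_nonempty with hS | hS
  · have hx_le : x ≤ 0 := ge_of_tendsto' (tendsto_measureReal_Iic_atBot ν) fun t =>
      (not_le.1 fun ht => (hS ▸ (show t ∈ S from ht) : t ∈ (∅ : Set ℝ))).le
    rw [hS, measure_empty, ENNReal.ofReal_of_nonpos hx_le]
  · have h_bdd : BddAbove S := ⟨b, fun t ht => (h_mono.reflect_lt (lt_of_le_of_lt ht hb)).le⟩
    have h_max : sSup S ∈ S := (isClosed_Iic.preimage h_cont).csSup_mem hS h_bdd
    have hS_eq : S = Iic (sSup S) :=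
      Subset.antisymm (fun t => le_csSup h_bdd) fun t ht => (h_mono ht).trans h_max
    obtain ⟨s, hs⟩ := mem_range_of_exists_le_of_exists_ge h_cont hS ⟨b, hb.le⟩
    have h_val : ν.real (Iic (sSup S)) = x :=
      le_antisymm h_max (hs ▸ h_mono (le_csSup h_bdd hs.le))
    rw [hS_eq, ← h_val, ofReal_measureReal]

theorem map_measureReal_Iic :
    ν.map (fun t => ν.real (Iic t)) = volume.restrict (Icc 0 (ν.real univ)) := by
  refine Measure.ext_of_Iic _ _ fun x => ?_
  rw [Measure.map_apply (continuous_measureReal_Iic ν).measurable measurableSet_Iic,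
    Measure.restrict_apply measurableSet_Iic, inter_comm, ← Ici_inter_Iic, inter_assoc,
    Iic_inter_Iic, Ici_inter_Iic, Real.volume_Icc, sub_zero]
  rcases lt_or_ge x (ν.real univ) with hx | hx
  · rw [measure_preimage_measureReal_Iic ν hx, inf_eq_right.2 hx.le]
  · have h_univ : (fun t => ν.real (Iic t)) ⁻¹' Iic x = univ :=
      eq_univ_of_forall fun t => (measureReal_mono (subset_univ _)).trans hx
    rw [h_univ, inf_eq_left.2 hx, ofReal_measureReal]

theorem integral_measureReal_Iic_pow (n : ℕ) :
    ∫ s, ν.real (Iic s) ^ n ∂ν = ν.real univ ^ (n + 1) / (n + 1) := by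
  rw [← integral_map (f := fun x => x ^ n) (continuous_measureReal_Iic ν).aemeasurable
      (continuous_pow n).aestronglyMeasurable, map_measureReal_Iic, integral_Icc_eq_integral_Ioc,
    ← intervalIntegral.integral_of_le measureReal_nonneg, integral_pow]
  simp

theorem setIntegral_measureReal_Icc_pow (a t : ℝ) (n : ℕ) :
    ∫ s in Icc a t, ν.real (Icc a s) ^ n ∂ν = ν.real (Icc a t) ^ (n + 1) / (n + 1) := by
  have h := integral_measureReal_Iic_pow (ν.restrict (Icc a t)) n
  rw [measureReal_restrict_apply_univ] at h
  rw [← h]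
  refine setIntegral_congr_fun measurableSet_Icc fun s hs => ?_
  have h_inter : Iic s ∩ Icc a t = Icc a s := by
    rw [inter_comm, ← Ici_inter_Iic, inter_assoc, Iic_inter_Iic, inf_eq_right.2 hs.2, Ici_inter_Iic]
  simp only [measureReal_restrict_apply measurableSet_Iic, h_inter]

end Distribution

section Volterra

theorem vectorIntegrableOn_Icc_of_continuous {E F : Type*} [NormedAddCommGroup E]
    [NormedAddCommGroup F] {φ : VectorMeasure ℝ F} [IsFiniteMeasure φ.variation] {f : ℝ → E}
    (hf : Continuous f) (a b : ℝ) : φ.IntegrableOn f (Icc a b) := by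
  unfold VectorMeasure.IntegrableOn VectorMeasure.Integrable
  rw [VectorMeasure.variation_restrict measurableSet_Icc]
  exact hf.integrableOn_Icc

variable {𝔄 : Type*} [NormedRing 𝔄] [NormedAlgebra ℝ 𝔄]

/-- The integral `∫ φ(s) f(s)` over a set, with the measure as the left factor. -/
noncomputable abbrev leftIntegral (φ : VectorMeasure ℝ 𝔄) (s : Set ℝ) (f : ℝ → 𝔄) : 𝔄 :=
  VectorMeasure.integral (φ.restrict s) f (ContinuousLinearMap.mul ℝ 𝔄).flip

theorem lexpTerm_succ (φ : VectorMeasure ℝ 𝔄) (a t : ℝ) (n : ℕ) :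
    lexpTerm φ a (n + 1) t = leftIntegral φ (Icc a t) (lexpTerm φ a n) := rfl

theorem norm_leftIntegral_le (φ : VectorMeasure ℝ 𝔄) {s : Set ℝ} (hs : MeasurableSet s)
    (f : ℝ → 𝔄) : ‖leftIntegral φ s f‖ ≤ ∫ x in s, ‖f x‖ ∂φ.variation := by
  refine VectorMeasure.norm_integral_le_integral_norm.trans ?_
  rw [VectorMeasure.variation_restrict hs, ContinuousLinearMap.opNorm_flip]
  exact mul_le_of_le_one_left (integral_nonneg fun _ => norm_nonneg _)
    (ContinuousLinearMap.opNorm_mul_le ℝ 𝔄)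

variable {φ : VectorMeasure ℝ 𝔄} [IsFiniteMeasure φ.variation] {a b : ℝ} {f : ℝ → 𝔄}

theorem norm_leftIntegral_Icc_sub_le (hf : Continuous f) (a : ℝ) {s t : ℝ} (hst : s ≤ t) :
    ‖leftIntegral φ (Icc a t) f - leftIntegral φ (Icc a s) f‖
      ≤ ∫ x in Icc a t \ Icc a s, ‖f x‖ ∂φ.variation := by
  rw [← VectorMeasure.setIntegral_sdiff measurableSet_Icc measurableSet_Icc
    (vectorIntegrableOn_Icc_of_continuous hf a t) (Icc_subset_Icc_right hst)]
  exact norm_leftIntegral_le φ (measurableSet_Icc.diff measurableSet_Icc) f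

variable [NullSingletonClass φ.variation]

theorem continuous_leftIntegral_Icc (hf : Continuous f) (a : ℝ) :
    Continuous fun t => leftIntegral φ (Icc a t) f := by
  have h_cont := continuous_setIntegral_Icc φ.variation hf.norm a
  set G := fun t => ∫ x in Icc a t, ‖f x‖ ∂φ.variation
  have h_le : ∀ s t, s ≤ t →
      dist (leftIntegral φ (Icc a t) f) (leftIntegral φ (Icc a s) f) ≤ dist (G t) (G s) := by
    intro s t hst
    rw [dist_eq_norm, dist_eq_norm, ← setIntegral_sdiff measurableSet_Icc hf.norm.integrableOn_Icc
      (Icc_subset_Icc_right hst)]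
    exact (norm_leftIntegral_Icc_sub_le hf a hst).trans (Real.le_norm_self _)
  refine continuous_iff_continuousAt.2 fun s => tendsto_iff_dist_tendsto_zero.2 ?_
  refine squeeze_zero (fun _ => dist_nonneg) (fun t => ?_)
    (tendsto_iff_dist_tendsto_zero.1 (h_cont.tendsto s))
  rcases le_total s t with hst | hts
  · exact h_le s t hst
  · rw [dist_comm, dist_comm (G t)]
    exact h_le t s hts

theorem norm_leftIntegral_Icc_le_of_norm_le_pow {M t : ℝ} {n : ℕ}
    (hf : ∀ s ∈ Icc a t, ‖f s‖ ≤ M * (φ.variation.real (Icc a s) ^ n / n.factorial)) :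
    ‖leftIntegral φ (Icc a t) f‖
      ≤ M * (φ.variation.real (Icc a t) ^ (n + 1) / (n + 1).factorial) := by
  have h_cont : Continuous fun s => M * (φ.variation.real (Icc a s) ^ n / n.factorial) :=
    continuous_const.mul (((continuous_measureReal_Icc _ a).pow n).div_const _)
  calc ‖leftIntegral φ (Icc a t) f‖ ≤ ∫ s in Icc a t, ‖f s‖ ∂φ.variation :=
        norm_leftIntegral_le φ measurableSet_Icc f
    _ ≤ ∫ s in Icc a t, M * (φ.variation.real (Icc a s) ^ n / n.factorial) ∂φ.variation :=
        integral_mono_of_nonneg (Eventually.of_forall fun _ => norm_nonneg _)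
          h_cont.integrableOn_Icc (ae_restrict_of_forall_mem measurableSet_Icc hf)
    _ = M * (φ.variation.real (Icc a t) ^ (n + 1) / (n + 1).factorial) := by
        rw [integral_const_mul, integral_div, setIntegral_measureReal_Icc_pow, div_div,
          Nat.factorial_succ, Nat.cast_mul, Nat.cast_succ]

theorem continuous_lexpTerm (φ : VectorMeasure ℝ 𝔄) [IsFiniteMeasure φ.variation]
    [NullSingletonClass φ.variation] (a : ℝ) (n : ℕ) : Continuous (lexpTerm φ a n) := by
  induction n with
  | zero => exact continuous_const
  | succ n ih => exact continuous_leftIntegral_Icc ih a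

theorem norm_lexpTerm_le (φ : VectorMeasure ℝ 𝔄) [IsFiniteMeasure φ.variation]
    [NullSingletonClass φ.variation] (a t : ℝ) (n : ℕ) :
    ‖lexpTerm φ a n t‖ ≤ ‖(1 : 𝔄)‖ * (φ.variation.real univ ^ n / n.factorial) := by
  have h_pow : ‖lexpTerm φ a n t‖
      ≤ ‖(1 : 𝔄)‖ * (φ.variation.real (Icc a t) ^ n / n.factorial) := by
    induction n generalizing t with
    | zero => simp [lexpTerm]
    | succ n ih => exact norm_leftIntegral_Icc_le_of_norm_le_pow fun s _ => ih s
  exact h_pow.trans (by gcongr; exacts [measure_ne_top _ _, subset_univ _])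

variable [CompleteSpace 𝔄]

theorem summable_lexpTerm (φ : VectorMeasure ℝ 𝔄) [IsFiniteMeasure φ.variation]
    [NullSingletonClass φ.variation] (a t : ℝ) : Summable fun n => lexpTerm φ a n t :=
  Summable.of_norm_bounded ((Real.summable_pow_div_factorial _).mul_left _)
    (norm_lexpTerm_le φ a t)

theorem continuous_lexp (φ : VectorMeasure ℝ 𝔄) [IsFiniteMeasure φ.variation]
    [NullSingletonClass φ.variation] (a : ℝ) : Continuous (lexp φ a) :=
  continuous_tsum (continuous_lexpTerm φ a) ((Real.summable_pow_div_factorial _).mul_left _)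
    fun n t => norm_lexpTerm_le φ a t n

theorem lexp_eq_one_add_leftIntegral (φ : VectorMeasure ℝ 𝔄) [IsFiniteMeasure φ.variation]
    [NullSingletonClass φ.variation] (a t : ℝ) :
    lexp φ a t = 1 + leftIntegral φ (Icc a t) (lexp φ a) := by
  have h_var : (φ.restrict (Icc a t)).variation = φ.variation.restrict (Icc a t) :=
    VectorMeasure.variation_restrict measurableSet_Icc
  have h_sum : HasSum (fun n => leftIntegral φ (Icc a t) (lexpTerm φ a n))
      (leftIntegral φ (Icc a t) (lexp φ a)) :=
    VectorMeasure.hasSum_integral_of_dominated_convergence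
      (fun n _ => ‖(1 : 𝔄)‖ * (φ.variation.real univ ^ n / n.factorial))
      (fun n => (continuous_lexpTerm φ a n).aestronglyMeasurable)
      (fun n => Eventually.of_forall fun s => norm_lexpTerm_le φ a s n)
      (Eventually.of_forall fun _ => (Real.summable_pow_div_factorial _).mul_left _)
      (by rw [h_var]; exact integrable_const _)
      (Eventually.of_forall fun s => (summable_lexpTerm φ a s).hasSum)
  rw [lexp, (summable_lexpTerm φ a t).tsum_eq_zero_add, ← h_sum.tsum_eq]
  rfl

theorem lexp_eq_of_eq_one_add_leftIntegral {U : ℝ → 𝔄} (hU : Continuous U)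
    (h_eq : ∀ t ∈ Icc a b, U t = 1 + leftIntegral φ (Icc a t) U) {t : ℝ} (ht : t ∈ Icc a b) :
    lexp φ a t = U t := by
  have h_diff : ∀ t ∈ Icc a b, lexp φ a t - U t
      = leftIntegral φ (Icc a t) fun s => lexp φ a s - U s := fun t ht => by
    rw [leftIntegral, VectorMeasure.integral_fun_sub
      (vectorIntegrableOn_Icc_of_continuous (continuous_lexp φ a) a t)
      (vectorIntegrableOn_Icc_of_continuous hU a t), h_eq t ht, lexp_eq_one_add_leftIntegral φ a t,
      add_sub_add_left_eq_sub]
  obtain ⟨C, hC⟩ := isCompact_Icc.exists_bound_of_continuousOn (s := Icc a b)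
    ((continuous_lexp φ a).sub hU).continuousOn
  have h_pow : ∀ n : ℕ, ∀ t ∈ Icc a b,
      ‖lexp φ a t - U t‖ ≤ C * (φ.variation.real (Icc a t) ^ n / n.factorial) := by
    intro n
    induction n with
    | zero => simpa using hC
    | succ n ih =>
      intro t ht
      rw [h_diff t ht]
      exact norm_leftIntegral_Icc_le_of_norm_le_pow fun s hs => ih s ⟨hs.1, hs.2.trans ht.2⟩
  have h_lim : Tendsto (fun n : ℕ => C * (φ.variation.real (Icc a t) ^ n / n.factorial)) atTop
      (𝓝 0) := by
    simpa using (FloorSemiring.tendsto_pow_div_factorial_atTop _).const_mul C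
  exact sub_eq_zero.1 (norm_le_zero_iff.1 (ge_of_tendsto' h_lim fun n => h_pow n t ht))

end Volterra

section Restrict

variable {𝔄 : Type*} [NormedRing 𝔄] {φ : VectorMeasure ℝ 𝔄} {a b : ℝ}

theorem isFiniteMeasure_variation_restrict {s : Set ℝ} (hs : MeasurableSet s)
    (h : φ.variation s ≠ ∞) : IsFiniteMeasure (φ.restrict s).variation := by
  rw [VectorMeasure.variation_restrict hs]
  exact ⟨by simpa using h.lt_top⟩

theorem nullSingletonClass_variation_restrict {s : Set ℝ} (hs : MeasurableSet s)
    (h : ∀ x ∈ s, φ {x} = 0) : NullSingletonClass (φ.restrict s).variation := by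
  refine ⟨fun x => (VectorMeasure.variation_apply_eq_zero (measurableSet_singleton x)).2 ?_⟩
  intro t ht h_meas
  rw [VectorMeasure.restrict_apply _ hs h_meas]
  rcases subset_singleton_iff_eq.1 (inter_subset_left.trans ht : t ∩ s ⊆ {x}) with h_eq | h_eq
  · rw [h_eq, VectorMeasure.empty]
  · rw [h_eq]
    exact h x (h_eq ▸ mem_singleton x : x ∈ t ∩ s).2

theorem lexpTerm_restrict [NormedAlgebra ℝ 𝔄] (n : ℕ) {t : ℝ} (ht : t ≤ b) :
    lexpTerm (φ.restrict (Icc a b)) a n t = lexpTerm φ a n t := by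
  induction n generalizing t with
  | zero => rfl
  | succ n ih =>
    rw [lexpTerm_succ, lexpTerm_succ, leftIntegral,
      VectorMeasure.restrict_restrict _ measurableSet_Icc measurableSet_Icc,
      inter_eq_left.2 (Icc_subset_Icc_right ht)]
    exact VectorMeasure.setIntegral_congr_fun fun s hs => ih (hs.2.trans ht)

theorem lexp_restrict [NormedAlgebra ℝ 𝔄] : lexp (φ.restrict (Icc a b)) a b = lexp φ a b :=
  tsum_congr fun n => lexpTerm_restrict n le_rfl

end Restrict

section Action

variable {𝔄 : Type*} [NormedRing 𝔄] [NormedAlgebra ℝ 𝔄] {X : Type*} [NormedAddCommGroup X]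
  [NormedSpace ℝ X] {φ : VectorMeasure ℝ 𝔄} {ρ : 𝔄 →ₐ[ℝ] X →L[ℝ] X}

theorem continuous_of_norm_apply_le (hρ : ∀ A, ‖ρ A‖ ≤ ‖A‖) : Continuous ρ :=
  AddMonoidHomClass.continuous_of_bound ρ 1 fun A => by simpa using hρ A

variable [CompleteSpace 𝔄] [CompleteSpace X]

theorem norm_action_leftIntegral_le (hρ : ∀ A, ‖ρ A‖ ≤ ‖A‖) {s : Set ℝ}
    {f : ℝ → 𝔄} (hf : φ.IntegrableOn f s) [IsFiniteMeasure φ.variation] (v : X) {C : ℝ}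
    (hC₀ : 0 ≤ C) (hC : ∀ r ∈ s, ‖ρ (f r) v‖ ≤ C) :
    ‖ρ (leftIntegral φ s f) v‖ ≤ C * φ.variation.real s := by
  let T : X →L[ℝ] 𝔄 →L[ℝ] X :=
    (ρ.toLinearMap.mkContinuous 1 fun A => by simpa using hρ A).flip
  have hT : ‖T‖ ≤ 1 := by
    rw [ContinuousLinearMap.opNorm_flip]
    exact LinearMap.mkContinuous_norm_le _ zero_le_one _
  have h_assoc : (ContinuousLinearMap.compL ℝ 𝔄 𝔄 X (T v)) ∘L (ContinuousLinearMap.mul ℝ 𝔄).flip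
      = T ∘L T v := by
    ext A B
    simp [T]
  have h_eq : ρ (leftIntegral φ s f) v
      = VectorMeasure.integral (φ.restrict s) (fun r => ρ (f r) v) T := by
    change T v (leftIntegral φ s f) = VectorMeasure.integral (φ.restrict s) (fun r => T v (f r)) T
    rw [VectorMeasure.integral_continuousLinearMap_comp hf, ← h_assoc,
      VectorMeasure.continuousLinearMap_apply_integral hf]
  rw [h_eq]
  refine (VectorMeasure.norm_setIntegral_le_of_norm_le_const hC).trans ?_
  gcongr
  exact mul_le_of_le_one_right hC₀ hT

variable [IsFiniteMeasure φ.variation] [NullSingletonClass φ.variation]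

theorem norm_action_lexp_sub_le (hρ : ∀ A, ‖ρ A‖ ≤ ‖A‖) (a : ℝ) {s t : ℝ} (hst : s ≤ t)
    (v : X) {C : ℝ} (hC₀ : 0 ≤ C) (hC : ∀ r ∈ Icc s t, ‖ρ (lexp φ a r) v‖ ≤ C) :
    ‖ρ (lexp φ a t) v - ρ (lexp φ a s) v‖
      ≤ C * (φ.variation.real (Icc a t) - φ.variation.real (Icc a s)) := by
  have h_int := vectorIntegrableOn_Icc_of_continuous (φ := φ) (continuous_lexp φ a) a t
  have h_sub : Icc a s ⊆ Icc a t := Icc_subset_Icc_right hst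
  rw [← sub_apply, ← map_sub, lexp_eq_one_add_leftIntegral φ a t,
    lexp_eq_one_add_leftIntegral φ a s, add_sub_add_left_eq_sub,
    ← VectorMeasure.setIntegral_sdiff measurableSet_Icc measurableSet_Icc h_int h_sub,
    ← measureReal_sdiff h_sub measurableSet_Icc]
  refine norm_action_leftIntegral_le hρ (h_int.mono measurableSet_Icc sdiff_subset) v hC₀
    fun r hr => hC r ⟨?_, hr.1.2⟩
  exact (not_le.1 fun h => hr.2 ⟨hr.1.1, h⟩).le

theorem norm_action_lexp_sub_le_div (hρ : ∀ A, ‖ρ A‖ ≤ ‖A‖) {a s t δ : ℝ} (hst : s ≤ t) (v : X)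
    (hδ : φ.variation.real (Icc a t) - φ.variation.real (Icc a s) ≤ δ) (hδ₁ : δ < 1) :
    ‖ρ (lexp φ a t) v - ρ (lexp φ a s) v‖ ≤ δ / (1 - δ) * ‖ρ (lexp φ a s) v‖ := by
  set u := fun r => ρ (lexp φ a r) v
  have hu : Continuous u := by
    have := continuous_of_norm_apply_le hρ
    have := continuous_lexp φ a
    fun_prop
  obtain ⟨r, hr, hr_max⟩ := isCompact_Icc.exists_isMaxOn (nonempty_Icc.2 hst) hu.norm.continuousOn
  have h_inc : ∀ x ∈ Icc s t, ‖u x - u s‖ ≤ ‖u r‖ * δ := fun x hx => by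
    refine (norm_action_lexp_sub_le hρ a hx.1 v (norm_nonneg (u r)) fun y hy =>
      hr_max ⟨hy.1, hy.2.trans hx.2⟩).trans ?_
    have : φ.variation.real (Icc a x) ≤ φ.variation.real (Icc a t) :=
      measureReal_mono (Icc_subset_Icc_right hx.2)
    gcongr
    linarith
  have h_max : ‖u r‖ ≤ ‖u s‖ / (1 - δ) := by
    rw [le_div_iff₀ (by linarith)]
    have := norm_le_norm_add_norm_sub' (u r) (u s)
    linarith [h_inc r hr]
  have hδ₀ : 0 ≤ δ := (sub_nonneg.2 (measureReal_mono (Icc_subset_Icc_right hst))).trans hδ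
  calc ‖u t - u s‖ ≤ ‖u r‖ * δ := h_inc t ⟨hst, le_rfl⟩
    _ ≤ ‖u s‖ / (1 - δ) * δ := by gcongr
    _ = δ / (1 - δ) * ‖u s‖ := by ring

theorem lexp_self (φ : VectorMeasure ℝ 𝔄) [IsFiniteMeasure φ.variation]
    [NullSingletonClass φ.variation] (a : ℝ) : lexp φ a a = 1 := by
  rw [lexp_eq_one_add_leftIntegral, Icc_self, leftIntegral,
    VectorMeasure.setIntegral_of_variation_apply_eq_zero _ (measure_singleton a), add_zero]

end Action

section Logarithm

theorem exists_exp_eq_one_add_of_norm_le_div {δ : ℝ} (hδ₀ : 0 ≤ δ) (hδ : δ ≤ 1 / 4) {z : ℂ}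
    (hz : ‖z‖ ≤ δ / (1 - δ)) : ∃ w, Complex.exp w = 1 + z ∧ ‖w‖ ≤ δ * (1 + 3 * δ) := by
  have h_div : δ / (1 - δ) ≤ δ * (1 + 4 / 3 * δ) := by
    rw [div_le_iff₀ (by linarith)]
    nlinarith [mul_nonneg hδ₀ hδ₀]
  have hz_lin : ‖z‖ ≤ 4 / 3 * δ := by nlinarith
  have hz_inv : (1 - ‖z‖)⁻¹ ≤ 3 / 2 := by
    rw [inv_le_comm₀ (by linarith) (by norm_num)]
    linarith
  have h_ne : 1 + z ≠ 0 := by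
    intro h
    rw [eq_neg_of_add_eq_zero_right h, norm_neg, norm_one] at hz_lin
    linarith
  refine ⟨Complex.log (1 + z), Complex.exp_log h_ne, ?_⟩
  calc ‖Complex.log (1 + z)‖ ≤ ‖z‖ ^ 2 * (1 - ‖z‖)⁻¹ / 2 + ‖z‖ :=
        Complex.norm_log_one_add_le (by linarith)
    _ ≤ (4 / 3 * δ) ^ 2 * (3 / 2) / 2 + δ * (1 + 4 / 3 * δ) := by
        have : 0 ≤ (1 - ‖z‖)⁻¹ := inv_nonneg.2 (by linarith)
        gcongr
        exact hz.trans h_div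
    _ ≤ δ * (1 + 3 * δ) := by nlinarith [mul_nonneg hδ₀ hδ₀]

theorem norm_log_exp_le (w : ℂ) : ‖Complex.log (Complex.exp w)‖ ≤ ‖w‖ := by
  by_cases h : w.im ∈ Ioc (-Real.pi) Real.pi
  · rw [Complex.log_exp h.1 h.2]
  have h_re : (Complex.log (Complex.exp w)).re = w.re := by
    rw [Complex.log_re, Complex.norm_exp, Real.log_exp]
  have h_im : |(Complex.log (Complex.exp w)).im| ≤ |w.im| := by
    rw [Complex.log_im]
    refine (Complex.abs_arg_le_pi _).trans (le_abs.2 ?_)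
    rw [mem_Ioc, not_and_or, not_lt, not_le] at h
    exact h.symm.imp le_of_lt le_neg_of_le_neg
  rw [Complex.norm_eq_sqrt_sq_add_sq, Complex.norm_eq_sqrt_sq_add_sq, h_re]
  exact Real.sqrt_le_sqrt (add_le_add_right (sq_le_sq.2 h_im) _)

end Logarithm

section LowerBound

variable {𝔄 : Type*} [NormedRing 𝔄] [NormedAlgebra ℝ 𝔄] [CompleteSpace 𝔄]
  {φ : VectorMeasure ℝ 𝔄} {ρ : 𝔄 →ₐ[ℝ] ℂ →L[ℝ] ℂ}

section Finite

variable [IsFiniteMeasure φ.variation] [NullSingletonClass φ.variation]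

theorem exists_action_lexp_eq_exp_mul_of_sub_le (hρ : ∀ A, ‖ρ A‖ ≤ ‖A‖) {a s t ε : ℝ}
    (hst : s ≤ t) {v : ℂ} (hs : ρ (lexp φ a s) v ≠ 0)
    (hε : φ.variation.real (Icc a t) - φ.variation.real (Icc a s) ≤ ε) (hε₁ : ε ≤ 1 / 4) :
    ∃ w, ρ (lexp φ a t) v = Complex.exp w * ρ (lexp φ a s) v ∧
      ‖w‖ ≤ (φ.variation.real (Icc a t) - φ.variation.real (Icc a s)) * (1 + 3 * ε) := by
  set δ := φ.variation.real (Icc a t) - φ.variation.real (Icc a s)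
  have hδ₀ : 0 ≤ δ := sub_nonneg.2 (measureReal_mono (Icc_subset_Icc_right hst))
  have h_sub := norm_action_lexp_sub_le_div hρ hst v (le_refl δ) (by linarith)
  rw [← div_le_iff₀ (norm_pos_iff.2 hs), ← norm_div] at h_sub
  obtain ⟨w, hw, hw_norm⟩ := exists_exp_eq_one_add_of_norm_le_div hδ₀ (hε.trans hε₁) h_sub
  refine ⟨w, ?_, hw_norm.trans (by gcongr)⟩
  rw [hw]
  field_simp
  ring

theorem exists_action_lexp_eq_exp_mul (hρ : ∀ A, ‖ρ A‖ ≤ ‖A‖) {a t ε : ℝ} (hat : a ≤ t)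
    {v : ℂ} (hv : v ≠ 0) (hε₀ : 0 < ε) (hε₁ : ε ≤ 1 / 4) :
    ∃ w, ρ (lexp φ a t) v = Complex.exp w * v ∧
      ‖w‖ ≤ φ.variation.real (Icc a t) * (1 + 3 * ε) := by
  set F := fun t => φ.variation.real (Icc a t)
  have hFa : F a = 0 := by simp [F, Measure.real]
  have h_start : ρ (lexp φ a a) v = v := by simp [lexp_self]
  obtain ⟨n, hn⟩ : ∃ n : ℕ, F t ≤ n * ε := by
    obtain ⟨n, hn⟩ := exists_nat_ge (F t / ε)
    exact ⟨n, (div_le_iff₀ hε₀).1 hn⟩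
  induction n generalizing t with
  | zero =>
    have h_small : F t - F a ≤ ε := by
      rw [Nat.cast_zero, zero_mul] at hn
      linarith
    have h_step := exists_action_lexp_eq_exp_mul_of_sub_le hρ hat (h_start.symm ▸ hv) h_small hε₁
    simpa only [h_start, hFa, sub_zero, F] using h_step
  | succ n ih =>
    obtain ⟨s, hs, hFs⟩ : max (F t - ε) 0 ∈ F '' Icc a t :=
      intermediate_value_Icc hat (continuous_measureReal_Icc _ a).continuousOn
        ⟨hFa ▸ le_max_right _ _, max_le (by linarith) measureReal_nonneg⟩
    obtain ⟨w₁, hw₁, hw₁_norm⟩ := ih hs.1 <| by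
      push_cast at hn
      rw [hFs]
      exact max_le (by linarith) (by positivity)
    have h_small : F t - F s ≤ ε := by linarith [le_max_left (F t - ε) 0]
    have h_ne : ρ (lexp φ a s) v ≠ 0 := hw₁ ▸ mul_ne_zero (Complex.exp_ne_zero _) hv
    obtain ⟨w₂, hw₂, hw₂_norm⟩ :=
      exists_action_lexp_eq_exp_mul_of_sub_le hρ hs.2 h_ne h_small hε₁
    refine ⟨w₂ + w₁, by rw [hw₂, hw₁, Complex.exp_add, mul_assoc], ?_⟩
    linarith [norm_add_le w₂ w₁]

theorem norm_log_action_lexp_div_le (hρ : ∀ A, ‖ρ A‖ ≤ ‖A‖) {a t : ℝ} (hat : a ≤ t) {v : ℂ}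
    (hv : v ≠ 0) : ‖Complex.log (ρ (lexp φ a t) v / v)‖ ≤ φ.variation.real (Icc a t) := by
  have h_lim : Tendsto (fun ε : ℝ => φ.variation.real (Icc a t) * (1 + 3 * ε)) (𝓝[>] 0)
      (𝓝 (φ.variation.real (Icc a t))) :=
    tendsto_nhdsWithin_of_tendsto_nhds (Continuous.tendsto' (by fun_prop) _ _ (by simp))
  refine ge_of_tendsto h_lim ?_
  filter_upwards [Ioc_mem_nhdsGT (show (0 : ℝ) < 1 / 4 by norm_num)] with ε hε
  obtain ⟨w, hw, hw_norm⟩ := exists_action_lexp_eq_exp_mul (φ := φ) hρ hat hv hε.1 hε.2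
  rw [hw, mul_div_cancel_right₀ _ hv]
  exact (norm_log_exp_le w).trans hw_norm

end Finite

theorem ofReal_norm_log_action_lexp_div_le (hρ : ∀ A, ‖ρ A‖ ≤ ‖A‖) {a b : ℝ} (hab : a ≤ b)
    (hφ : ∀ x ∈ Icc a b, φ {x} = 0) {v : ℂ} (hv : v ≠ 0) :
    ENNReal.ofReal ‖Complex.log (ρ (lexp φ a b) v / v)‖ ≤ φ.variation (Icc a b) := by
  by_cases h_top : φ.variation (Icc a b) = ∞
  · exact h_top ▸ le_top
  have := isFiniteMeasure_variation_restrict measurableSet_Icc h_top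
  have := nullSingletonClass_variation_restrict measurableSet_Icc hφ
  refine ENNReal.ofReal_le_of_le_toReal ?_
  have h := norm_log_action_lexp_div_le (φ := φ.restrict (Icc a b)) hρ hab hv
  rwa [lexp_restrict, VectorMeasure.variation_restrict measurableSet_Icc,
    measureReal_restrict_apply_self] at h

end LowerBound

section ChiralMatrix

open scoped Matrix.Norms.L2Operator ComplexConjugate

/-- The real matrix of the map `v ↦ p v + q v̄` of the plane `ℂ ≅ ℝ²`, as a function of `(p, q)`.
In these coordinates the chiral disk has center `p` and radius `‖q‖`. -/
noncomputable def chiralMatrix : (ℂ × ℂ) ≃ₗ[ℝ] Matrix (Fin 2) (Fin 2) ℝ where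
  toFun x := !![x.1.re + x.2.re, x.2.im - x.1.im; x.1.im + x.2.im, x.1.re - x.2.re]
  invFun A := (⟨(A 0 0 + A 1 1) / 2, (A 1 0 - A 0 1) / 2⟩,
    ⟨(A 0 0 - A 1 1) / 2, (A 0 1 + A 1 0) / 2⟩)
  map_add' x y := by
    ext i j
    fin_cases i <;> fin_cases j <;> simp <;> ring
  map_smul' c x := by
    ext i j
    fin_cases i <;> fin_cases j <;> simp <;> ring
  left_inv x := by
    apply Prod.ext <;> apply Complex.ext <;> simp <;> ring
  right_inv A := by
    ext i j
    fin_cases i <;> fin_cases j <;> simp <;> ring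

theorem chiralMatrix_apply (p q : ℂ) :
    chiralMatrix (p, q) = !![p.re + q.re, q.im - p.im; p.im + q.im, p.re - q.re] :=
  rfl

theorem chiralDisk_chiralMatrix (p q : ℂ) :
    chiralDisk (chiralMatrix (p, q)) = Metric.closedBall p ‖q‖ := by
  have h : chiralMatrix.symm (chiralMatrix (p, q)) = (p, q) := chiralMatrix.symm_apply_apply _
  calc chiralDisk (chiralMatrix (p, q))
      = Metric.closedBall (chiralMatrix.symm (chiralMatrix (p, q))).1
          ‖(chiralMatrix.symm (chiralMatrix (p, q))).2‖ := by
        rw [Complex.norm_eq_sqrt_sq_add_sq]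
        rfl
    _ = Metric.closedBall p ‖q‖ := by rw [h]

theorem chiralMatrix_one : chiralMatrix (1, 0) = 1 := by
  ext i j
  fin_cases i <;> fin_cases j <;> simp [chiralMatrix_apply]

theorem chiralMatrix_mul (x y p q : ℂ) :
    chiralMatrix (x, y) * chiralMatrix (p, q)
      = chiralMatrix (x * p + y * conj q, x * q + y * conj p) := by
  ext i j
  fin_cases i <;> fin_cases j <;>
    simp [chiralMatrix_apply, Matrix.mul_apply, Fin.sum_univ_two] <;> ring

theorem norm_conjStarAlgEquiv {𝕜 H K : Type*} [RCLike 𝕜] [NormedAddCommGroup H]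
    [InnerProductSpace 𝕜 H] [CompleteSpace H] [NormedAddCommGroup K] [InnerProductSpace 𝕜 K]
    [CompleteSpace K] (e : H ≃ₗᵢ[𝕜] K) (f : H →L[𝕜] H) : ‖e.conjStarAlgEquiv f‖ = ‖f‖ := by
  have h_eq : e.conjStarAlgEquiv f
      = (e : H →L[𝕜] K) ∘L f ∘L (e.symm : K →L[𝕜] H) := by
    ext
    rfl
  rw [h_eq, ContinuousLinearMap.opNorm_linearIsometryEquiv_comp,
    ContinuousLinearMap.opNorm_comp_linearIsometryEquiv]

/-- The action of real `2 × 2` matrices on the plane, identified with `ℂ`. -/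
noncomputable def planeAction : Matrix (Fin 2) (Fin 2) ℝ →ₐ[ℝ] ℂ →L[ℝ] ℂ :=
  (Matrix.toEuclideanCLM.trans
    Complex.orthonormalBasisOneI.repr.symm.conjStarAlgEquiv).toAlgEquiv.toAlgHom

theorem planeAction_apply (A : Matrix (Fin 2) (Fin 2) ℝ) :
    planeAction A = Complex.orthonormalBasisOneI.repr.symm.conjStarAlgEquiv
      (Matrix.toEuclideanCLM (𝕜 := ℝ) A) :=
  rfl

theorem planeAction_chiralMatrix (p q v : ℂ) :
    planeAction (chiralMatrix (p, q)) v = p * v + q * conj v := by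
  rw [planeAction_apply, LinearIsometryEquiv.conjStarAlgEquiv_apply_apply,
    LinearIsometryEquiv.symm_apply_eq]
  ext i
  fin_cases i <;>
    simp [chiralMatrix_apply, Matrix.ofLp_toEuclideanCLM, Matrix.mulVec, dotProduct,
      Fin.sum_univ_two] <;> ring

theorem norm_planeAction (A : Matrix (Fin 2) (Fin 2) ℝ) : ‖planeAction A‖ = ‖A‖ := by
  rw [planeAction_apply, norm_conjStarAlgEquiv, Matrix.l2_opNorm_toEuclideanCLM]

theorem norm_chiralMatrix_le (p q : ℂ) : ‖chiralMatrix (p, q)‖ ≤ ‖p‖ + ‖q‖ := by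
  rw [← norm_planeAction]
  refine ContinuousLinearMap.opNorm_le_bound _ (by positivity) fun v => ?_
  rw [planeAction_chiralMatrix, add_mul]
  exact (norm_add_le _ _).trans_eq (by simp)

theorem exists_planeAction_chiralMatrix_div_eq {p q z : ℂ} (hz : z ∈ Metric.sphere p ‖q‖) :
    ∃ v ≠ 0, planeAction (chiralMatrix (p, q)) v / v = z := by
  rw [mem_sphere_iff_norm] at hz
  obtain ⟨s, hs, hsq⟩ : ∃ s : ℂ, ‖s‖ = 1 ∧ q * (s * s) = z - p := by
    rcases eq_or_ne q 0 with rfl | hq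
    · rw [norm_zero, norm_eq_zero] at hz
      exact ⟨1, norm_one, by rw [zero_mul, hz]⟩
    obtain ⟨s, hs⟩ := IsAlgClosed.exists_eq_mul_self ((z - p) / q)
    refine ⟨s, ?_, by rw [← hs, mul_div_cancel₀ _ hq]⟩
    have h := congrArg norm hs
    rw [norm_div, hz, div_self (norm_ne_zero_iff.2 hq), norm_mul] at h
    nlinarith [norm_nonneg s]
  have hs₀ : s ≠ 0 := norm_ne_zero_iff.1 (hs ▸ one_ne_zero)
  refine ⟨conj s, (map_ne_zero _).2 hs₀, ?_⟩
  have h_inv : s * conj s = 1 := by rw [Complex.mul_conj']; simp [hs]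
  rw [div_eq_iff ((map_ne_zero _).2 hs₀), planeAction_chiralMatrix, Complex.conj_conj]
  linear_combination (conj s) * hsq - q * s * h_inv

theorem le_magnusExponent_of_mem_sphere {p q z : ℂ} (hz : z ∈ Metric.sphere p ‖q‖) :
    ENNReal.ofReal ‖Complex.log z‖ ≤ magnusExponent (chiralMatrix (p, q)) := by
  refine le_sInf ?_
  rintro _ ⟨a, b, φ, ⟨hab, hφ, h_lexp⟩, rfl⟩
  obtain ⟨v, hv, rfl⟩ := exists_planeAction_chiralMatrix_div_eq hz
  rw [← h_lexp]
  exact ofReal_norm_log_action_lexp_div_le (fun A => (norm_planeAction A).le) hab hφ hv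

end ChiralMatrix

section Density

theorem isFiniteMeasure_variation_withDensityᵥ {α F : Type*} [MeasurableSpace α]
    [NormedAddCommGroup F] [NormedSpace ℝ F] [CompleteSpace F] {μ : Measure α} {Φ : α → F}
    (hΦ : Integrable Φ μ) : IsFiniteMeasure (μ.withDensityᵥ Φ).variation := by
  rw [Measure.variation_withDensityᵥ hΦ]
  exact isFiniteMeasure_withDensity hΦ.2.ne

theorem variation_withDensityᵥ_absolutelyContinuous {α F : Type*} [MeasurableSpace α]
    [NormedAddCommGroup F] [NormedSpace ℝ F] [CompleteSpace F] {μ : Measure α} {Φ : α → F}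
    (hΦ : Integrable Φ μ) : (μ.withDensityᵥ Φ).variation ≪ μ := by
  rw [Measure.variation_withDensityᵥ hΦ]
  exact withDensity_absolutelyContinuous _ _

variable {α E F G : Type*} [MeasurableSpace α] [NormedAddCommGroup E] [NormedSpace ℝ E]
  [NormedAddCommGroup F] [NormedSpace ℝ F] [CompleteSpace F] [NormedAddCommGroup G]
  [NormedSpace ℝ G] [CompleteSpace G] (B : E →L[ℝ] F →L[ℝ] G) {μ : Measure α} {Φ : α → F}

theorem integral_withDensityᵥ_simpleFunc (hΦ : Integrable Φ μ) (f : SimpleFunc α E) :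
    VectorMeasure.integral (μ.withDensityᵥ Φ) f B = ∫ x, B (f x) (Φ x) ∂μ := by
  have := isFiniteMeasure_variation_withDensityᵥ hΦ
  induction f using SimpleFunc.induction with
  | @const c s hs =>
    classical
    rw [SimpleFunc.coe_piecewise, SimpleFunc.coe_const, SimpleFunc.coe_const,
      Function.const_zero, piecewise_eq_indicator]
    refine (VectorMeasure.integral_indicator_const c hs).trans ?_
    rw [withDensityᵥ_apply hΦ hs, ← (B c).integral_comp_comm hΦ.integrableOn,
      ← integral_indicator hs]
    congr 1
    funext x
    by_cases hx : x ∈ s <;> simp [indicator, hx]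
  | @add f g _ hf hg =>
    have h_int : ∀ h : SimpleFunc α E, Integrable (fun x => B (h x) (Φ x)) μ := fun h => by
      obtain ⟨C, hC⟩ := h.exists_forall_norm_le
      refine (hΦ.norm.const_mul (‖B‖ * C)).mono' ?_ (Eventually.of_forall fun x => ?_)
      · exact B.aestronglyMeasurable_comp₂ h.aestronglyMeasurable hΦ.aestronglyMeasurable
      · exact B.le_of_opNorm₂_le_of_le le_rfl (hC x) le_rfl
    rw [SimpleFunc.coe_add, VectorMeasure.integral_add (SimpleFunc.integrable_of_isFiniteMeasure f)
      (SimpleFunc.integrable_of_isFiniteMeasure g), hf, hg, ← integral_add (h_int f) (h_int g)]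
    simp

theorem integral_withDensityᵥ (hΦ : Integrable Φ μ) {f : α → E} (hf : StronglyMeasurable f)
    {c : ℝ} (hc₀ : 0 ≤ c) (hc : ∀ᵐ x ∂μ, ‖f x‖ ≤ c) :
    VectorMeasure.integral (μ.withDensityᵥ Φ) f B = ∫ x, B (f x) (Φ x) ∂μ := by
  have := isFiniteMeasure_variation_withDensityᵥ hΦ
  have h_approx := hf.tendsto_approxBounded_ae hc
  have h_left : Tendsto (fun n => VectorMeasure.integral (μ.withDensityᵥ Φ)
      (hf.approxBounded c n) B) atTop (𝓝 (VectorMeasure.integral (μ.withDensityᵥ Φ) f B)) :=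
    VectorMeasure.tendsto_integral_of_dominated_convergence (fun _ => c)
      (fun n => (hf.approxBounded c n).aestronglyMeasurable) (integrable_const _)
      (fun n => Eventually.of_forall fun x => hf.norm_approxBounded_le hc₀ n x)
      ((variation_withDensityᵥ_absolutelyContinuous hΦ).ae_le h_approx)
  have h_right : Tendsto (fun n => ∫ x, B (hf.approxBounded c n x) (Φ x) ∂μ) atTop
      (𝓝 (∫ x, B (f x) (Φ x) ∂μ)) := by
    refine tendsto_integral_of_dominated_convergence (fun x => ‖B‖ * c * ‖Φ x‖) (fun n => ?_)
      (hΦ.norm.const_mul _) (fun n => Eventually.of_forall fun x => ?_) ?_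
    · exact B.aestronglyMeasurable_comp₂ (hf.approxBounded c n).aestronglyMeasurable
        hΦ.aestronglyMeasurable
    · exact B.le_of_opNorm₂_le_of_le le_rfl (hf.norm_approxBounded_le hc₀ n x) le_rfl
    · filter_upwards [h_approx] with x hx
      exact ((B.flip (Φ x)).continuous.tendsto _).comp hx
  simp only [integral_withDensityᵥ_simpleFunc B hΦ] at h_left
  exact tendsto_nhds_unique h_left h_right

end Density

section LinearODE

theorem restrict_withDensityᵥ_restrict {α F : Type*} [MeasurableSpace α] [NormedAddCommGroup F]
    [NormedSpace ℝ F] {μ : Measure α} {Φ : α → F} {s t : Set α} (ht : MeasurableSet t)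
    (hts : t ⊆ s) (hΦ : IntegrableOn Φ s μ) :
    ((μ.restrict s).withDensityᵥ Φ).restrict t = (μ.restrict t).withDensityᵥ Φ := by
  ext r hr
  rw [VectorMeasure.restrict_apply _ ht hr, withDensityᵥ_apply hΦ (hr.inter ht),
    withDensityᵥ_apply (hΦ.mono_set hts) hr, Measure.restrict_restrict (hr.inter ht),
    Measure.restrict_restrict hr, inter_assoc, inter_eq_left.2 hts]

theorem withDensityᵥ_singleton {α F : Type*} [MeasurableSpace α] [MeasurableSingletonClass α]
    [NormedAddCommGroup F] [NormedSpace ℝ F] {μ : Measure α} [NullSingletonClass μ] {Φ : α → F}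
    (hΦ : Integrable Φ μ) (x : α) : μ.withDensityᵥ Φ {x} = 0 := by
  rw [withDensityᵥ_apply hΦ (measurableSet_singleton x)]
  exact setIntegral_measure_zero Φ (measure_singleton x)

theorem lexp_withDensityᵥ {𝔄 : Type*} [NormedRing 𝔄] [NormedAlgebra ℝ 𝔄] [CompleteSpace 𝔄]
    {Φ U : ℝ → 𝔄} {a b : ℝ} (hab : a ≤ b) (hΦ : Continuous Φ) (hUa : U a = 1)
    (hU : ∀ t, HasDerivAt U (Φ t * U t) t) :
    lexp ((volume.restrict (Icc a b)).withDensityᵥ Φ) a b = U b := by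
  have hU_cont : Continuous U := continuous_iff_continuousAt.2 fun t => (hU t).continuousAt
  have hΦ_int : IntegrableOn Φ (Icc a b) := hΦ.integrableOn_Icc
  have := isFiniteMeasure_variation_withDensityᵥ hΦ_int
  have : NullSingletonClass ((volume.restrict (Icc a b)).withDensityᵥ Φ).variation :=
    ⟨fun x => variation_withDensityᵥ_absolutelyContinuous hΦ_int (measure_singleton x)⟩
  refine lexp_eq_of_eq_one_add_leftIntegral hU_cont (fun t ht => ?_) (right_mem_Icc.2 hab)
  obtain ⟨C, hC⟩ := isCompact_Icc.exists_bound_of_continuousOn (s := Icc a t) hU_cont.continuousOn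
  have hC_ae : ∀ᵐ x ∂volume.restrict (Icc a t), ‖U x‖ ≤ C :=
    (ae_restrict_mem measurableSet_Icc).mono hC
  have hC₀ : 0 ≤ C := (norm_nonneg _).trans (hC a (left_mem_Icc.2 ht.1))
  rw [leftIntegral, restrict_withDensityᵥ_restrict measurableSet_Icc (Icc_subset_Icc_right ht.2)
    hΦ_int, integral_withDensityᵥ _ hΦ.integrableOn_Icc hU_cont.stronglyMeasurable hC₀ hC_ae,
    integral_Icc_eq_integral_Ioc, ← intervalIntegral.integral_of_le ht.1]
  simp only [ContinuousLinearMap.flip_apply, ContinuousLinearMap.mul_apply']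
  rw [intervalIntegral.integral_eq_sub_of_hasDerivAt (fun s _ => hU s)
      ((hΦ.mul hU_cont).intervalIntegrable _ _), hUa, add_sub_cancel]

open scoped Matrix.Norms.L2Operator in
theorem magnusExponent_le_of_hasDerivAt {Φ U : ℝ → Matrix (Fin 2) (Fin 2) ℝ} {a b : ℝ}
    (hab : a ≤ b) (hΦ : Continuous Φ) (hΦ_norm : ∀ t, ‖Φ t‖ ≤ 1) (hUa : U a = 1)
    (hU : ∀ t, HasDerivAt U (Φ t * U t) t) : magnusExponent (U b) ≤ ENNReal.ofReal (b - a) := by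
  have hΦ_int : IntegrableOn Φ (Icc a b) := hΦ.integrableOn_Icc
  calc magnusExponent (U b)
      ≤ cumulativeNorm a b ((volume.restrict (Icc a b)).withDensityᵥ Φ) :=
        sInf_le ⟨a, b, _, ⟨hab, fun x _ => withDensityᵥ_singleton hΦ_int x,
          lexp_withDensityᵥ hab hΦ hUa hU⟩, rfl⟩
    _ = ∫⁻ x in Icc a b, ‖Φ x‖ₑ := by
        rw [cumulativeNorm, Measure.variation_withDensityᵥ hΦ_int,
          withDensity_apply _ measurableSet_Icc, Measure.restrict_restrict measurableSet_Icc,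
          inter_self]
    _ ≤ ∫⁻ _ in Icc a b, 1 :=
        lintegral_mono fun x =>
          (ofReal_norm (Φ x)).symm.trans_le (ENNReal.ofReal_le_one.2 (hΦ_norm x))
    _ = ENNReal.ofReal (b - a) := by simp

end LinearODE

section Flow

open scoped Matrix.Norms.L2Operator ComplexConjugate

/-- The function `sinh (c τ) / c`, defined as an integral so that the case `c = 0` is included. -/
noncomputable def sinhDiv (c τ : ℝ) : ℝ :=
  ∫ s in 0..τ, Real.cosh (c * s)

theorem sinhDiv_zero (c : ℝ) : sinhDiv c 0 = 0 :=
  intervalIntegral.integral_same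

theorem sinhDiv_zero_left (τ : ℝ) : sinhDiv 0 τ = τ := by
  simp [sinhDiv]

theorem hasDerivAt_sinhDiv (c τ : ℝ) : HasDerivAt (sinhDiv c) (Real.cosh (c * τ)) τ :=
  (Real.continuous_cosh.comp (continuous_const_mul c)).integral_hasStrictDerivAt 0 τ |>.hasDerivAt

theorem continuous_sinhDiv (c : ℝ) : Continuous (sinhDiv c) :=
  continuous_iff_continuousAt.2 fun τ => (hasDerivAt_sinhDiv c τ).continuousAt

theorem mul_sinhDiv (c τ : ℝ) : c * sinhDiv c τ = Real.sinh (c * τ) := by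
  rw [sinhDiv, intervalIntegral.mul_integral_comp_mul_left, mul_zero,
    intervalIntegral.integral_eq_sub_of_hasDerivAt (fun x _ => Real.hasDerivAt_sinh x)
      (Real.continuous_cosh.intervalIntegrable _ _), Real.sinh_zero, sub_zero]

theorem hasDerivAt_cosh_smul_one_add_sinhDiv_smul {𝔄 : Type*} [NormedRing 𝔄] [NormedAlgebra ℝ 𝔄]
    {N : 𝔄} {c : ℝ} (hN : N * N = (c ^ 2) • (1 : 𝔄)) (t : ℝ) :
    HasDerivAt (fun t => Real.cosh (c * t) • (1 : 𝔄) + sinhDiv c t • N)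
      (N * (Real.cosh (c * t) • (1 : 𝔄) + sinhDiv c t • N)) t := by
  have h_cosh : HasDerivAt (fun t => Real.cosh (c * t)) (Real.sinh (c * t) * (c * 1)) t :=
    ((hasDerivAt_id t).const_mul c).cosh
  refine ((h_cosh.smul_const (1 : 𝔄)).add ((hasDerivAt_sinhDiv c t).smul_const N)).congr_deriv ?_
  rw [← mul_sinhDiv, mul_add, mul_smul_comm, mul_smul_comm, hN, mul_one N, mul_one c, smul_smul,
    add_comm]
  congr 2
  ring

theorem hasDerivAt_chiralMatrix {p q : ℝ → ℂ} {p' q' : ℂ} {t : ℝ} (hp : HasDerivAt p p' t)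
    (hq : HasDerivAt q q' t) :
    HasDerivAt (fun s => chiralMatrix (p s, q s)) (chiralMatrix (p', q')) t :=
  chiralMatrix.toContinuousLinearEquiv.hasFDerivAt.comp_hasDerivAt t (hp.prodMk hq)

theorem chiralMatrix_sq_eq_smul_one {c ω : ℝ} {k : ℂ} (hcω : c ^ 2 + ω ^ 2 = 1) (hk : ‖k‖ = 1) :
    chiralMatrix (-(ω * Complex.I), k) * chiralMatrix (-(ω * Complex.I), k)
      = (c ^ 2) • (1 : Matrix (Fin 2) (Fin 2) ℝ) := by
  have hk' : k * conj k = 1 := by simp [Complex.mul_conj', hk]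
  have hcω' : (c : ℂ) ^ 2 + (ω : ℂ) ^ 2 = 1 := by exact_mod_cast hcω
  rw [chiralMatrix_mul, ← chiralMatrix_one, ← map_smul, Prod.smul_mk, smul_zero]
  congr 2
  · rw [Complex.real_smul]
    push_cast
    linear_combination hk' - hcω' + (ω : ℂ) ^ 2 * Complex.I_sq
  · simp only [map_neg, map_mul, Complex.conj_ofReal, Complex.conj_I]
    ring

/-- The solution of the linear differential equation with coefficient
`chiralMatrix ((1 - ρ) (c + ω i), ρ k exp (2 ω t i))`, whose antilinear part rotates uniformly. -/
noncomputable def rotatingFlow (c ω ρ : ℝ) (k : ℂ) (t : ℝ) : Matrix (Fin 2) (Fin 2) ℝ :=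
  chiralMatrix (Complex.exp (t * ((1 - ρ) * c + ω * Complex.I)), 0) *
    (Real.cosh (c * (ρ * t)) • (1 : Matrix (Fin 2) (Fin 2) ℝ)
      + sinhDiv c (ρ * t) • chiralMatrix (-(ω * Complex.I), k))

theorem rotatingFlow_eq_chiralMatrix (c ω ρ : ℝ) (k : ℂ) (t : ℝ) :
    rotatingFlow c ω ρ k t = chiralMatrix
      (Complex.exp (t * ((1 - ρ) * c + ω * Complex.I)) *
        (Real.cosh (c * (ρ * t)) - ω * Complex.I * sinhDiv c (ρ * t)),
      Complex.exp (t * ((1 - ρ) * c + ω * Complex.I)) * (sinhDiv c (ρ * t) * k)) := by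
  rw [rotatingFlow, ← chiralMatrix_one, ← map_smul, ← map_smul, ← map_add, Prod.smul_mk,
    Prod.smul_mk, Prod.mk_add_mk, chiralMatrix_mul]
  congr 2 <;> simp only [Complex.real_smul] <;> ring

theorem rotatingFlow_zero (c ω ρ : ℝ) (k : ℂ) : rotatingFlow c ω ρ k 0 = 1 := by
  simp [rotatingFlow, sinhDiv_zero, chiralMatrix_one]

theorem exp_two_mul_mul_conj_exp (x ω t : ℝ) :
    Complex.exp (2 * ω * t * Complex.I) * conj (Complex.exp (t * (x + ω * Complex.I)))
      = Complex.exp (t * (x + ω * Complex.I)) := by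
  rw [← Complex.exp_conj, ← Complex.exp_add]
  congr 1
  simp only [map_add, map_mul, Complex.conj_ofReal, Complex.conj_I]
  ring

theorem hasDerivAt_rotatingFlow {c ω ρ : ℝ} {k : ℂ} (hcω : c ^ 2 + ω ^ 2 = 1) (hk : ‖k‖ = 1)
    (t : ℝ) : HasDerivAt (rotatingFlow c ω ρ k)
      (chiralMatrix ((1 - ρ) * (c + ω * Complex.I), ρ * k * Complex.exp (2 * ω * t * Complex.I))
        * rotatingFlow c ω ρ k t) t := by
  set z : ℂ := (1 - ρ) * c + ω * Complex.I with hz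
  have h_exp : HasDerivAt (fun t : ℝ => Complex.exp (t * z)) (Complex.exp (t * z) * z) t := by
    simpa using ((hasDerivAt_id t).ofReal_comp.mul_const z).cexp
  have h_rot : Complex.exp (2 * ω * t * Complex.I) * conj (Complex.exp (t * z))
      = Complex.exp (t * z) := by
    have h := exp_two_mul_mul_conj_exp ((1 - ρ) * c) ω t
    push_cast at h
    exact h
  have h_inner := (hasDerivAt_cosh_smul_one_add_sinhDiv_smul
    (chiralMatrix_sq_eq_smul_one hcω hk) (ρ * t)).scomp t ((hasDerivAt_id t).const_mul ρ)
  refine ((hasDerivAt_chiralMatrix h_exp (hasDerivAt_const t 0)).mul h_inner).congr_deriv ?_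
  rw [mul_one, mul_smul_comm, ← Matrix.mul_assoc, ← smul_mul_assoc, Function.comp_apply,
    ← add_mul, rotatingFlow, ← Matrix.mul_assoc]
  congr 1
  rw [chiralMatrix_mul, chiralMatrix_mul, ← map_smul, ← map_add, Prod.smul_mk, Prod.mk_add_mk]
  congr 2
  · simp only [Complex.real_smul, map_zero]
    rw [hz]
    ring
  · simp only [Complex.real_smul]
    linear_combination (-(ρ * k)) * h_rot

theorem magnusExponent_rotatingFlow_le {c ω ρ : ℝ} {k : ℂ} (hcω : c ^ 2 + ω ^ 2 = 1)
    (hk : ‖k‖ = 1) (hρ : ρ ∈ Icc (0 : ℝ) 1) {l : ℝ} (hl : 0 ≤ l) :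
    magnusExponent (rotatingFlow c ω ρ k l) ≤ ENNReal.ofReal l := by
  have h_cont : Continuous fun t : ℝ => chiralMatrix
      ((1 - ρ) * (c + ω * Complex.I), ρ * k * Complex.exp (2 * ω * t * Complex.I)) :=
    chiralMatrix.toContinuousLinearEquiv.continuous.comp (by fun_prop)
  have h := magnusExponent_le_of_hasDerivAt hl h_cont (fun t => ?_) (rotatingFlow_zero c ω ρ k)
    (hasDerivAt_rotatingFlow hcω hk)
  · rwa [sub_zero] at h
  have h_dir : ‖(c : ℂ) + ω * Complex.I‖ = 1 := by
    rw [Complex.norm_add_mul_I, hcω, Real.sqrt_one]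
  have h_rot : ‖Complex.exp (2 * ω * t * Complex.I)‖ = 1 := by
    exact_mod_cast Complex.norm_exp_ofReal_mul_I (2 * ω * t)
  have h_left : ‖(1 : ℂ) - ρ‖ = 1 - ρ := by
    exact_mod_cast Complex.norm_of_nonneg (sub_nonneg.2 hρ.2)
  calc _ ≤ ‖(1 - ρ) * (c + ω * Complex.I)‖ + ‖ρ * k * Complex.exp (2 * ω * t * Complex.I)‖ :=
        norm_chiralMatrix_le _ _
    _ = 1 := by
      rw [norm_mul, norm_mul, norm_mul, h_dir, h_rot, h_left, hk, Complex.norm_of_nonneg hρ.1]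
      ring

end Flow

section UpperBound

/-- The center of the disk of radius `r` that touches the curve `|log z| = l` at
`exp (l (c + ω i))` from the inside, where `c ^ 2 + ω ^ 2 = 1`. -/
noncomputable def tangentCenter (c ω l r : ℝ) : ℂ :=
  Complex.exp (l * ω * Complex.I) * (Real.exp (l * c) - r * (c + ω * Complex.I))

theorem exp_mul_cosh_eq_sub (c l ρ : ℝ) :
    Real.exp ((1 - ρ) * c * l) * Real.cosh (c * (ρ * l))
      = Real.exp (l * c) - Real.exp ((1 - ρ) * c * l) * sinhDiv c (ρ * l) * c := by
  have h_cosh : Real.cosh (c * (ρ * l)) = Real.exp (c * (ρ * l)) - c * sinhDiv c (ρ * l) := by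
    rw [mul_sinhDiv, ← Real.cosh_add_sinh, add_sub_cancel_right]
  have h_exp : Real.exp (l * c) = Real.exp ((1 - ρ) * c * l) * Real.exp (c * (ρ * l)) := by
    rw [← Real.exp_add]
    congr 1
    ring
  rw [h_cosh, h_exp]
  ring

theorem rotatingFlow_eq_chiralMatrix_tangentCenter (c ω ρ : ℝ) (k : ℂ) (l : ℝ) :
    rotatingFlow c ω ρ k l = chiralMatrix
      (tangentCenter c ω l (Real.exp ((1 - ρ) * c * l) * sinhDiv c (ρ * l)),
      Complex.exp (l * ω * Complex.I) *
        ((Real.exp ((1 - ρ) * c * l) * sinhDiv c (ρ * l) : ℝ) * k)) := by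
  have h_exp : Complex.exp (l * ((1 - ρ) * c + ω * Complex.I))
      = Complex.exp (l * ω * Complex.I) * Real.exp ((1 - ρ) * c * l) := by
    rw [Complex.ofReal_exp, ← Complex.exp_add]
    congr 1
    push_cast
    ring
  have h_cosh := congrArg (fun x : ℝ => (x : ℂ)) (exp_mul_cosh_eq_sub c l ρ)
  rw [rotatingFlow_eq_chiralMatrix, tangentCenter, h_exp]
  push_cast at h_cosh ⊢
  congr 2
  · linear_combination Complex.exp (l * ω * Complex.I) * h_cosh
  · ring

theorem exists_exp_mul_sinhDiv_eq {c r l : ℝ} (hr : 0 ≤ r) (hrl : r ≤ sinhDiv c l) :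
    ∃ ρ ∈ Icc (0 : ℝ) 1, Real.exp ((1 - ρ) * c * l) * sinhDiv c (ρ * l) = r := by
  have h_cont : Continuous fun ρ : ℝ => Real.exp ((1 - ρ) * c * l) * sinhDiv c (ρ * l) := by
    have := continuous_sinhDiv c
    fun_prop
  have h_ivt := intermediate_value_Icc zero_le_one h_cont.continuousOn
  simp only [zero_mul, sinhDiv_zero, mul_zero, sub_self, Real.exp_zero, one_mul] at h_ivt
  exact h_ivt ⟨hr, hrl⟩

theorem magnusExponent_tangentCenter_le {c ω l : ℝ} {q : ℂ} (hcω : c ^ 2 + ω ^ 2 = 1) (hl : 0 ≤ l)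
    (hq : ‖q‖ ≤ sinhDiv c l) :
    magnusExponent (chiralMatrix (tangentCenter c ω l ‖q‖, q)) ≤ ENNReal.ofReal l := by
  obtain ⟨ρ, hρ, hρq⟩ := exists_exp_mul_sinhDiv_eq (norm_nonneg q) hq
  set k : ℂ := Complex.exp ((q.arg - l * ω : ℝ) * Complex.I) with hk
  have hkq : Complex.exp (l * ω * Complex.I) * (‖q‖ * k) = q := by
    rw [hk, mul_left_comm, ← Complex.exp_add]
    convert Complex.norm_mul_exp_arg_mul_I q using 3
    push_cast
    ring
  have h_flow := rotatingFlow_eq_chiralMatrix_tangentCenter c ω ρ k l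
  rw [hρq, hkq] at h_flow
  rw [← h_flow]
  exact magnusExponent_rotatingFlow_le hcω (Complex.norm_exp_ofReal_mul_I _) hρ hl

end UpperBound

section Tangency

open scoped ComplexConjugate

theorem inner_fderivWithin_sub_nonpos {E F : Type*} [NormedAddCommGroup E] [NormedSpace ℝ E]
    [NormedAddCommGroup F] [InnerProductSpace ℝ F] {f : E → F} {f' : E →L[ℝ] F} {s : Set E}
    {x y : E} (hs : Convex ℝ s) (hx : x ∈ s) (hy : y ∈ s) (hf : HasFDerivWithinAt f f' s x)
    (hmax : IsMaxOn (fun z => ‖f z‖) s x) : inner ℝ (f x) (f' (y - x)) ≤ 0 := by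
  have hmax_sq : IsMaxOn (‖f ·‖ ^ 2) s x := fun z hz =>
    pow_le_pow_left₀ (norm_nonneg _) (hmax hz) 2
  have h := hmax_sq.localize.hasFDerivWithinAt_nonpos hf.norm_sq
    (sub_mem_posTangentConeAt_of_segment_subset (hs.segment_subset hx hy))
  have h_two : 2 * inner ℝ (f x) (f' (y - x)) ≤ 0 := by simpa using h
  linarith

theorem sub_eq_smul_of_forall_inner_sub_nonpos {E : Type*} [NormedAddCommGroup E]
    [InnerProductSpace ℝ E] {n p x : E} {r : ℝ} (hn : n ≠ 0) (hx : x ∈ Metric.closedBall p r)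
    (h : ∀ y ∈ Metric.closedBall p r, inner ℝ n (y - x) ≤ 0) : x - p = (r / ‖n‖) • n := by
  have hn' : 0 < ‖n‖ := norm_pos_iff.2 hn
  have hr : 0 ≤ r := dist_nonneg.trans hx
  have h_far : p + (r / ‖n‖) • n ∈ Metric.closedBall p r := by
    rw [mem_closedBall_iff_norm, add_sub_cancel_left, norm_smul, norm_div, norm_norm,
      div_mul_cancel₀ _ hn'.ne', Real.norm_of_nonneg hr]
  have h_inner : r * ‖n‖ ≤ inner ℝ n (x - p) := by
    have h_le := h _ h_far
    rw [add_comm, add_sub_assoc, ← neg_sub x p, ← sub_eq_add_neg, inner_sub_right,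
      inner_smul_right, real_inner_self_eq_norm_sq, sub_nonpos] at h_le
    calc r * ‖n‖ = r / ‖n‖ * ‖n‖ ^ 2 := by field_simp
      _ ≤ _ := h_le
  have hx' : ‖x - p‖ ≤ r := mem_closedBall_iff_norm.1 hx
  have h_norm : ‖x - p‖ = r := le_antisymm hx' <|
    le_of_mul_le_mul_left (by linarith [real_inner_le_norm n (x - p)]) hn'
  have h_eq : inner ℝ n (x - p) = ‖n‖ * ‖x - p‖ :=
    le_antisymm (real_inner_le_norm _ _) (by rwa [h_norm, mul_comm])
  rw [inner_eq_norm_mul_iff_real, h_norm] at h_eq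
  rw [div_eq_inv_mul, mul_smul, h_eq, inv_smul_smul₀ hn'.ne']

theorem inner_mul_left_eq_sq_norm_mul_inner_div {z : ℂ} (w h : ℂ) (hz : z ≠ 0) :
    inner ℝ (w * z) h = ‖z‖ ^ 2 * inner ℝ w (h / z) := by
  rw [Complex.inner, Complex.inner, ← Complex.re_ofReal_mul, Complex.ofReal_pow,
    ← Complex.conj_mul', map_mul]
  congr 1
  field_simp

theorem sub_eq_smul_of_isMaxOn_norm_log {p z₀ : ℂ} {r : ℝ} (hz₀ : z₀ ∈ Metric.closedBall p r)
    (h_slit : z₀ ∈ Complex.slitPlane) (h_log : Complex.log z₀ ≠ 0)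
    (hmax : IsMaxOn (fun z => ‖Complex.log z‖) (Metric.closedBall p r) z₀) :
    z₀ - p = (r / ‖Complex.log z₀ * z₀‖) • (Complex.log z₀ * z₀) := by
  have hz₀_ne := Complex.slitPlane_ne_zero h_slit
  refine sub_eq_smul_of_forall_inner_sub_nonpos (mul_ne_zero h_log hz₀_ne) hz₀ fun z hz => ?_
  have h_deriv : HasFDerivWithinAt Complex.log _ (Metric.closedBall p r) z₀ :=
    ((Complex.hasStrictDerivAt_log h_slit).hasDerivAt.hasFDerivAt.restrictScalars
      ℝ).hasFDerivWithinAt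
  have h := inner_fderivWithin_sub_nonpos (convex_closedBall p r) hz₀ hz h_deriv hmax
  have h' : inner ℝ (Complex.log z₀) ((z - z₀) / z₀) ≤ 0 := by simpa [div_eq_mul_inv] using h
  rw [inner_mul_left_eq_sq_norm_mul_inner_div _ _ hz₀_ne]
  exact mul_nonpos_of_nonneg_of_nonpos (sq_nonneg _) h'

theorem mem_sphere_of_isMaxOn_norm_log {p z₀ : ℂ} {r : ℝ} (hz₀ : z₀ ∈ Metric.closedBall p r)
    (h_slit : z₀ ∈ Complex.slitPlane) (h_log : Complex.log z₀ ≠ 0)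
    (hmax : IsMaxOn (fun z => ‖Complex.log z‖) (Metric.closedBall p r) z₀) :
    z₀ ∈ Metric.sphere p r := by
  have h_ne : ‖Complex.log z₀ * z₀‖ ≠ 0 :=
    norm_ne_zero_iff.2 (mul_ne_zero h_log (Complex.slitPlane_ne_zero h_slit))
  rw [mem_sphere_iff_norm, sub_eq_smul_of_isMaxOn_norm_log hz₀ h_slit h_log hmax, norm_smul,
    norm_div, norm_norm, div_mul_cancel₀ _ h_ne, Real.norm_of_nonneg (dist_nonneg.trans hz₀)]

theorem center_eq_tangentCenter_of_isMaxOn_norm_log {p z₀ : ℂ} {c ω l r : ℝ}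
    (hcω : c ^ 2 + ω ^ 2 = 1) (hl : 0 < l) (hz₀ : z₀ ∈ Metric.closedBall p r)
    (h_slit : z₀ ∈ Complex.slitPlane) (h_log : Complex.log z₀ = l * (c + ω * Complex.I))
    (hmax : IsMaxOn (fun z => ‖Complex.log z‖) (Metric.closedBall p r) z₀) :
    p = tangentCenter c ω l r := by
  have h_dir : ‖(c : ℂ) + ω * Complex.I‖ = 1 := by
    rw [Complex.norm_add_mul_I, hcω, Real.sqrt_one]
  have h_ne : Complex.log z₀ ≠ 0 := by
    rw [h_log]
    exact mul_ne_zero (Complex.ofReal_ne_zero.2 hl.ne') (norm_ne_zero_iff.1 (by simp [h_dir]))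
  have h_exp : z₀ = Real.exp (l * c) * Complex.exp (l * ω * Complex.I) := by
    rw [← Complex.exp_log (Complex.slitPlane_ne_zero h_slit), h_log, Complex.ofReal_exp,
      ← Complex.exp_add]
    congr 1
    push_cast
    ring
  have h_norm : ‖z₀‖ = Real.exp (l * c) := by
    rw [h_exp, norm_mul, ← Complex.ofReal_mul, Complex.norm_exp_ofReal_mul_I, mul_one,
      Complex.norm_of_nonneg (Real.exp_pos _).le]
  have h := sub_eq_smul_of_isMaxOn_norm_log hz₀ h_slit h_ne hmax
  rw [norm_mul, h_norm, h_log, norm_mul, h_dir, mul_one, Complex.norm_of_nonneg hl.le,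
    Complex.real_smul, h_exp] at h
  have h_lexp : (l : ℂ) * Real.exp (l * c) ≠ 0 := by
    exact_mod_cast (mul_pos hl (Real.exp_pos _)).ne'
  have h_scalar : ((r / (l * Real.exp (l * c)) : ℝ) : ℂ) * (l * Real.exp (l * c)) = r := by
    rw [Complex.ofReal_div, Complex.ofReal_mul, div_mul_cancel₀ _ h_lexp]
  rw [tangentCenter]
  linear_combination -h - (c + ω * Complex.I) * Complex.exp (l * ω * Complex.I) * h_scalar

end Tangency

section RadiusBound

theorem sinhDiv_pos (c : ℝ) {τ : ℝ} (hτ : 0 < τ) : 0 < sinhDiv c τ :=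
  intervalIntegral.intervalIntegral_pos_of_pos
    ((Real.continuous_cosh.comp (continuous_const_mul c)).intervalIntegrable _ _)
    (fun _ => Real.cosh_pos _) hτ

theorem log_exp_of_abs_im_lt {w : ℂ} (hw : |w.im| < Real.pi) :
    Complex.log (Complex.exp w) = w :=
  Complex.log_exp (abs_lt.1 hw).1 (abs_lt.1 hw).2.le

theorem exp_mem_slitPlane_of_abs_im_lt {w : ℂ} (hw : |w.im| < Real.pi) :
    Complex.exp w ∈ Complex.slitPlane := by
  refine Complex.mem_slitPlane_iff_arg.2 ⟨?_, Complex.exp_ne_zero w⟩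
  rw [← Complex.log_im, log_exp_of_abs_im_lt hw]
  exact (abs_lt.1 hw).2.ne

theorem sq_norm_exp_sub_tangentCenter (c ω l r x y : ℝ) :
    ‖Complex.exp (x + (l * ω + y : ℝ) * Complex.I) - tangentCenter c ω l r‖ ^ 2
      = (Real.exp x * Real.cos y - (Real.exp (l * c) - r * c)) ^ 2
        + (Real.exp x * Real.sin y + r * ω) ^ 2 := by
  have h_rot : Complex.exp (x + (l * ω + y : ℝ) * Complex.I) - tangentCenter c ω l r
      = Complex.exp ((l * ω : ℝ) * Complex.I) *
        ((Real.exp x * Real.cos y - (Real.exp (l * c) - r * c) : ℝ)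
          + (Real.exp x * Real.sin y + r * ω : ℝ) * Complex.I) := by
    have h_exp : Complex.exp (x + (l * ω + y : ℝ) * Complex.I)
        = Complex.exp ((l * ω : ℝ) * Complex.I)
          * (Complex.exp x * (Complex.cos y + Complex.sin y * Complex.I)) := by
      rw [← Complex.exp_mul_I, ← Complex.exp_add, ← Complex.exp_add]
      congr 1
      push_cast
      ring
    rw [h_exp, tangentCenter]
    push_cast
    ring
  rw [h_rot, norm_mul, Complex.norm_exp_ofReal_mul_I, one_mul, Complex.norm_add_mul_I,
    Real.sq_sqrt (by positivity)]

theorem radius_le_sinhDiv_of_ne_zero {c ω l r : ℝ} (hc : c ≠ 0) (hcω : c ^ 2 + ω ^ 2 = 1)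
    (hl : 0 < l) (hlπ : l < Real.pi)
    (hmax : ∀ z ∈ Metric.closedBall (tangentCenter c ω l r) r, ‖Complex.log z‖ ≤ l) :
    r ≤ sinhDiv c l := by
  by_contra! hr
  have h_sinh := sinhDiv_pos c hl
  -- The mirror image of the point of tangency lies on the same level curve of `|log|`.
  set w : ℂ := (-(l * c) : ℝ) + (l * ω + 0 : ℝ) * Complex.I with hw
  have h_norm : ‖w‖ = l := by
    have h_sq : (-(l * c)) ^ 2 + (l * ω + 0) ^ 2 = l ^ 2 := by linear_combination l ^ 2 * hcω
    rw [hw, Complex.norm_add_mul_I, h_sq, Real.sqrt_sq hl.le]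
  have h_im : |w.im| < Real.pi := (Complex.abs_im_le_norm w).trans_lt (h_norm ▸ hlπ)
  have h_log := log_exp_of_abs_im_lt h_im
  have h_ball : Complex.exp w ∈ Metric.ball (tangentCenter c ω l r) r := by
    have h_gap : Real.exp (l * c) - Real.exp (-(l * c)) = 2 * (c * sinhDiv c l) := by
      rw [mul_sinhDiv, Real.sinh_eq, mul_comm c l]
      ring
    have h_pos : 0 < 4 * c ^ 2 * sinhDiv c l * (r - sinhDiv c l) :=
      mul_pos (by positivity) (sub_pos.2 hr)
    rw [mem_ball_iff_norm, ← sq_lt_sq₀ (norm_nonneg _) (h_sinh.trans hr).le, hw,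
      sq_norm_exp_sub_tangentCenter, Real.cos_zero, Real.sin_zero, mul_one, mul_zero, zero_add]
    calc _ = (r * c - 2 * (c * sinhDiv c l)) ^ 2 + (r * ω) ^ 2 := by rw [← h_gap]; ring
      _ = r ^ 2 - 4 * c ^ 2 * sinhDiv c l * (r - sinhDiv c l) := by
        linear_combination r ^ 2 * hcω
      _ < r ^ 2 := sub_lt_self _ h_pos
  have h_sphere := mem_sphere_of_isMaxOn_norm_log (Metric.ball_subset_closedBall h_ball)
    (exp_mem_slitPlane_of_abs_im_lt h_im)
    (by rw [h_log, ← norm_pos_iff, h_norm]; exact hl)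
    (fun z hz => (hmax z hz).trans_eq (h_norm.symm.trans (congrArg norm h_log.symm)))
  exact (Metric.mem_ball.1 h_ball).ne h_sphere

theorem exists_exp_mul_le_cos_add_mul_sin {l r : ℝ} (hl : 0 < l) (hlr : l < r) :
    ∃ β ∈ Ioo 0 l, Real.exp (l * β) ≤ Real.cos β + r * Real.sin β := by
  have h_deriv :
      HasDerivAt (fun β => Real.cos β + r * Real.sin β - Real.exp (l * β)) (r - l) 0 := by
    have h := ((Real.hasDerivAt_cos 0).add ((Real.hasDerivAt_sin 0).const_mul r)).sub
      (((hasDerivAt_id (0 : ℝ)).const_mul l).exp)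
    exact h.congr_deriv (by simp)
  have h_slope := h_deriv.tendsto_slope.eventually (lt_mem_nhds (sub_pos.2 hlr))
  obtain ⟨β, hβ, hβl⟩ := ((h_slope.filter_mono (nhdsGT_le_nhdsNE 0)).and
    (Ioo_mem_nhdsGT hl)).exists
  refine ⟨β, hβl, ?_⟩
  rw [slope_def_field, sub_zero, div_pos_iff_of_pos_right hβl.1] at hβ
  simp only [Real.cos_zero, Real.sin_zero, mul_zero, Real.exp_zero] at hβ
  linarith

theorem exp_mem_closedBall_tangentCenter_zero {ω r x β : ℝ} (l : ℝ) (hω : ω ^ 2 = 1) (hr : 0 ≤ r)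
    (h_cosh : Real.cosh x ≤ Real.cos β + r * Real.sin β) :
    Complex.exp (x + (l * ω + -(β * ω) : ℝ) * Complex.I)
      ∈ Metric.closedBall (tangentCenter 0 ω l r) r := by
  have hcos : Real.cos (-(β * ω)) = Real.cos β := by
    rcases sq_eq_one_iff.1 hω with rfl | rfl <;> simp
  have hsin : Real.sin (-(β * ω)) = -(ω * Real.sin β) := by
    rcases sq_eq_one_iff.1 hω with rfl | rfl <;> simp
  have h_exp_cosh : Real.exp x ^ 2 + 1 = 2 * (Real.exp x * Real.cosh x) := by
    rw [Real.cosh_eq, Real.exp_neg]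
    field_simp
  rw [mem_closedBall_iff_norm, ← sq_le_sq₀ (norm_nonneg _) hr, sq_norm_exp_sub_tangentCenter,
    hcos, hsin, mul_zero, mul_zero, Real.exp_zero, sub_zero]
  calc _ = 2 * (Real.exp x * (Real.cosh x - (Real.cos β + r * Real.sin β))) + r ^ 2 := by
        linear_combination h_exp_cosh + Real.exp x ^ 2 * Real.sin_sq_add_cos_sq β +
          (Real.exp x ^ 2 * Real.sin β ^ 2 - 2 * r * Real.exp x * Real.sin β + r ^ 2) * hω
    _ ≤ r ^ 2 := by
      have h_neg := mul_nonpos_of_nonneg_of_nonpos (Real.exp_pos x).le (sub_nonpos.2 h_cosh)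
      linarith

theorem radius_le_of_tangentCenter_zero {ω l r : ℝ} (hω : ω ^ 2 = 1) (hl : 0 < l)
    (hlπ : l < Real.pi)
    (hmax : ∀ z ∈ Metric.closedBall (tangentCenter 0 ω l r) r, ‖Complex.log z‖ ≤ l) : r ≤ l := by
  by_contra! hr
  -- The mirror image is now the point of tangency itself; the disk has points
  -- outside the level curve nearby, namely `exp (x + (l - β) ω i)` with `x ^ 2 = 2 l β`.
  obtain ⟨β, hβ, h_exp⟩ := exists_exp_mul_le_cos_add_mul_sin hl hr
  have hx : √(2 * (l * β)) ^ 2 = 2 * (l * β) :=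
    Real.sq_sqrt (mul_nonneg zero_le_two (mul_pos hl hβ.1).le)
  set x := √(2 * (l * β))
  have h_cosh : Real.cosh x ≤ Real.cos β + r * Real.sin β := by
    refine (Real.cosh_le_exp_half_sq x).trans ?_
    rwa [hx, mul_div_cancel_left₀ _ two_ne_zero]
  have h_sq : (l * ω + -(β * ω)) ^ 2 = (l - β) ^ 2 := by linear_combination (l - β) ^ 2 * hω
  have h_im : |l * ω + -(β * ω)| < Real.pi := by
    rw [← sq_abs, sq_eq_sq₀ (abs_nonneg _) (sub_pos.2 hβ.2).le] at h_sq
    linarith [hβ.1]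
  have h_le := hmax _ (exp_mem_closedBall_tangentCenter_zero l hω (hl.trans hr).le h_cosh)
  rw [log_exp_of_abs_im_lt (by simpa using h_im), Complex.norm_add_mul_I,
    Real.sqrt_le_left hl.le, h_sq, hx] at h_le
  nlinarith [hβ.1]

theorem radius_le_sinhDiv {c ω l r : ℝ} (hcω : c ^ 2 + ω ^ 2 = 1) (hl : 0 < l)
    (hlπ : l < Real.pi)
    (hmax : ∀ z ∈ Metric.closedBall (tangentCenter c ω l r) r, ‖Complex.log z‖ ≤ l) :
    r ≤ sinhDiv c l := by
  rcases eq_or_ne c 0 with rfl | hc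
  · rw [sinhDiv_zero_left]
    exact radius_le_of_tangentCenter_zero (by simpa using hcω) hl hlπ hmax
  · exact radius_le_sinhDiv_of_ne_zero hc hcω hl hlπ hmax

end RadiusBound

theorem norm_log_lt_pi_of_mem_exp_ball {z : ℂ}
    (hz : z ∈ Complex.exp '' Metric.ball (0 : ℂ) Real.pi) : ‖Complex.log z‖ < Real.pi := by
  obtain ⟨w, hw, rfl⟩ := hz
  exact (norm_log_exp_le w).trans_lt (mem_ball_zero_iff.1 hw)

theorem exp_ball_subset_slitPlane :
    Complex.exp '' Metric.ball (0 : ℂ) Real.pi ⊆ Complex.slitPlane := by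
  rintro _ ⟨w, hw, rfl⟩
  exact exp_mem_slitPlane_of_abs_im_lt
    ((Complex.abs_im_le_norm w).trans_lt (mem_ball_zero_iff.1 hw))

theorem isLeast_norm_log_of_isMaxOn {s : Set ℂ} {z₀ : ℂ}
    (hs : s ⊆ Complex.exp '' Metric.ball (0 : ℂ) Real.pi) (hz₀ : z₀ ∈ s)
    (hmax : IsMaxOn (fun z => ‖Complex.log z‖) s z₀) :
    IsLeast {l : ℝ | l ∈ Ico 0 Real.pi ∧ s ⊆ Complex.exp '' Metric.closedBall (0 : ℂ) l}
      ‖Complex.log z₀‖ := by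
  refine ⟨⟨⟨norm_nonneg _, norm_log_lt_pi_of_mem_exp_ball (hs hz₀)⟩, fun z hz => ?_⟩, ?_⟩
  · exact ⟨Complex.log z, mem_closedBall_zero_iff.2 (hmax hz),
      Complex.exp_log (Complex.slitPlane_ne_zero (exp_ball_subset_slitPlane (hs hz)))⟩
  · rintro l ⟨-, hl⟩
    obtain ⟨w, hw, rfl⟩ := hl hz₀
    exact (norm_log_exp_le w).trans (mem_closedBall_zero_iff.1 hw)

theorem eq_one_and_eq_zero_of_log_eq_zero {p q : ℂ}
    (h_slit : Metric.closedBall p ‖q‖ ⊆ Complex.slitPlane)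
    (h_log : ∀ z ∈ Metric.closedBall p ‖q‖, Complex.log z = 0) : p = 1 ∧ q = 0 := by
  have h_one : ∀ z ∈ Metric.closedBall p ‖q‖, z = 1 := fun z hz => by
    rw [← Complex.exp_log (Complex.slitPlane_ne_zero (h_slit hz)), h_log z hz, Complex.exp_zero]
  have hp := h_one p (Metric.mem_closedBall_self (norm_nonneg q))
  have hpq := h_one (p + q) (by simp)
  exact ⟨hp, by simpa [hp] using hpq⟩

theorem magnusExponent_chiralMatrix_le_of_isMaxOn {p q z₀ : ℂ}
    (h_slit : Metric.closedBall p ‖q‖ ⊆ Complex.slitPlane) (hz₀ : z₀ ∈ Metric.closedBall p ‖q‖)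
    (hπ : ‖Complex.log z₀‖ < Real.pi)
    (hmax : IsMaxOn (fun z => ‖Complex.log z‖) (Metric.closedBall p ‖q‖) z₀) :
    magnusExponent (chiralMatrix (p, q)) ≤ ENNReal.ofReal ‖Complex.log z₀‖ := by
  rcases (norm_nonneg (Complex.log z₀)).eq_or_lt with h_zero | h_pos
  · obtain ⟨rfl, rfl⟩ := eq_one_and_eq_zero_of_log_eq_zero h_slit fun z hz =>
      norm_le_zero_iff.1 ((hmax hz).trans_eq h_zero.symm)
    have h := magnusExponent_rotatingFlow_le (c := 1) (ω := 0) (ρ := 0) (k := 1) (by norm_num)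
      norm_one (left_mem_Icc.2 zero_le_one) le_rfl
    rwa [rotatingFlow_zero, ← chiralMatrix_one, h_zero] at h
  · have hcω := Real.cos_sq_add_sin_sq (Complex.log z₀).arg
    have h_center := center_eq_tangentCenter_of_isMaxOn_norm_log hcω h_pos hz₀ (h_slit hz₀)
      (by simp) hmax
    have h_radius := radius_le_sinhDiv hcω h_pos hπ (h_center ▸ hmax)
    have h := magnusExponent_tangentCenter_le hcω h_pos.le h_radius
    rwa [← h_center] at h

theorem le_magnusExponent_chiralMatrix_of_isMaxOn {p q z₀ : ℂ} (h_slit : z₀ ∈ Complex.slitPlane)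
    (hz₀ : z₀ ∈ Metric.closedBall p ‖q‖)
    (hmax : IsMaxOn (fun z => ‖Complex.log z‖) (Metric.closedBall p ‖q‖) z₀) :
    ENNReal.ofReal ‖Complex.log z₀‖ ≤ magnusExponent (chiralMatrix (p, q)) := by
  rcases eq_or_ne (Complex.log z₀) 0 with h_zero | h_ne
  · simp [h_zero]
  · exact le_magnusExponent_of_mem_sphere
      (mem_sphere_of_isMaxOn_norm_log hz₀ h_slit h_ne hmax)

theorem magnusExponent_eq_of_isMaxOn {A : Matrix (Fin 2) (Fin 2) ℝ} {z₀ : ℂ}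
    (hA : chiralDisk A ⊆ Complex.exp '' Metric.ball (0 : ℂ) Real.pi) (hz₀ : z₀ ∈ chiralDisk A)
    (hmax : IsMaxOn (fun z => ‖Complex.log z‖) (chiralDisk A) z₀) :
    magnusExponent A = ENNReal.ofReal ‖Complex.log z₀‖ := by
  obtain ⟨⟨p, q⟩, rfl⟩ := chiralMatrix.surjective A
  have hπ := norm_log_lt_pi_of_mem_exp_ball (hA hz₀)
  have h_slit := hA.trans exp_ball_subset_slitPlane
  rw [chiralDisk_chiralMatrix] at hz₀ hmax h_slit
  exact le_antisymm (magnusExponent_chiralMatrix_le_of_isMaxOn h_slit hz₀ hπ hmax)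
    (le_magnusExponent_chiralMatrix_of_isMaxOn (h_slit hz₀) hz₀ hmax)

theorem exists_isMaxOn_norm_log_chiralDisk {A : Matrix (Fin 2) (Fin 2) ℝ}
    (hA : chiralDisk A ⊆ Complex.slitPlane) :
    ∃ z₀ ∈ chiralDisk A, IsMaxOn (fun z => ‖Complex.log z‖) (chiralDisk A) z₀ :=
  (isCompact_closedBall _ _).exists_isMaxOn (Metric.nonempty_closedBall.2 (Real.sqrt_nonneg _))
    (continuousOn_id.clog hA).norm

end Magnus

theorem mainTheorem10 (A : Matrix (Fin 2) (Fin 2) ℝ)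
    (hA : Magnus.chiralDisk A ⊆ Complex.exp '' Metric.ball (0 : ℂ) Real.pi) :
    Magnus.magnusExponent A ≠ ⊤ ∧
    IsLeast {l : ℝ | l ∈ Set.Ico 0 Real.pi ∧
        Magnus.chiralDisk A ⊆ Complex.exp '' Metric.closedBall (0 : ℂ) l}
      (Magnus.magnusExponent A).toReal ∧
    IsLUB ((fun z : ℂ => ‖Complex.log z‖) '' Magnus.chiralDisk A)
      (Magnus.magnusExponent A).toReal := by
  obtain ⟨z₀, hz₀, hmax⟩ :=
    Magnus.exists_isMaxOn_norm_log_chiralDisk (hA.trans Magnus.exp_ball_subset_slitPlane)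
  rw [Magnus.magnusExponent_eq_of_isMaxOn hA hz₀ hmax, ENNReal.toReal_ofReal (norm_nonneg _)]
  exact ⟨ENNReal.ofReal_ne_top, Magnus.isLeast_norm_log_of_isMaxOn hA hz₀ hmax,
    IsGreatest.isLUB ⟨mem_image_of_mem _ hz₀, forall_mem_image.2 hmax⟩⟩
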